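/- Consider a catalogue $[N]$ of products and display positions $[K]$, with $1\le K\le N$, and a horizon $T\ge 1$. A feasible decision is a pair $(S,\sigma)$ with $S\subseteq[N]$, $|S|\le K$ and $\sigma:S\to[K]$ injective; $\mathcal F$ is the set of feasible decisions. For $\alpha=(\alpha_{i,k})\in[0,\infty)^{N\times K}$ let $P_\alpha(i\mid S,\sigma)=\frac{\alpha_{i,\sigma(i)}}{1+\sum_{j\in S}\alpha_{j,\sigma(j)}}$ for $i\in S$ and $P_\alpha(0\mid S,\sigma)=\frac{1}{1+\sum_{j\in S}\alpha_{j,\sigma(j)}}$, and, for known revenues $r_i\in[0,1]$, let $R(S,\sigma;\alpha)=\sum_{i\in S}r_iP_\alpha(i\mid S,\sigma)$. In the general position effects model the true attractions $v^\star_{i,k}\in(0,1]$ are arbitrary and unknown, one for each product–position pair. In each round $t=1,\dots,T$ a policy $\pi$ offers $(S_t,\sigma_t)\in\mathcal F$, chosen (possibly at random) on the basis of the past, and the customer's choice $i_t\in S_t\cup\{0\}$ is then drawn from $P_{v^\star}(\cdot\mid S_t,\sigma_t)$. Put $$\mathrm{Regret}(T,\pi)=\mathbb E\Big[\sum_{t=1}^T\Big(\max_{(S,\sigma)\in\mathcal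 F}R(S,\sigma;v^\star)-R(S_t,\sigma_t;v^\star)\Big)\Big],\qquad V_{\max}=\max_{(S,\sigma)\in\mathcal F}\sum_{i\in S}v^\star_{i,\sigma(i)}.$$ The algorithm GP2-UCB with horizon $T$ sets $\delta=2/(3KNT)$ and $L=\log\big(2(\lceil\log_2T\rceil+1)/\delta\big)$. At round $t$, let $n^t_{i,k}$ be the number of rounds $s<t$ with $i\in S_s$, $\sigma_s(i)=k$ and $i_s\in\{i,0\}$, and let $w^t_{i,k}$ be the number of those with $i_s=i$. If $n^t_{i,k}>0$, it sets $\hat p^t_{i,k}=w^t_{i,k}/n^t_{i,k}$, $$p^{t,\mathrm{ucb}}_{i,k}=\min\Big\{\hat p^t_{i,k}+2\sqrt{\hat p^t_{i,k}(1-\hat p^t_{i,k})L/n^t_{i,k}}+6L/n^t_{i,k},\ \tfrac12\Big\},\qquad v^{t,\mathrm{ucb}}_{i,k}=\frac{p^{t,\mathrm{ucb}}_{i,k}}{1-p^{t,\mathrm{ucb}}_{i,k}},$$ and otherwise $v^{t,\mathrm{ucb}}_{i,k}=1$. It then offers some $(S_t,\sigma_t)\in\arg\max_{(S,\sigma)\in\mathcal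 F}R(S,\sigma;v^{t,\mathrm{ucb}})$, with ties broken in any way. **Theorem.** For every instance of the general position effects model, the expected cumulative regret of GP2-UCB satisfies $$\mathrm{Regret}(T,\pi)\le 1+KN\cdot\max\big\{2\log(3KNT^2)(1+V_{\max})^2,\ 160\log\big(3KNT(\lceil\log_2T\rceil+1)\big)(1+K)^2\big\}+4\sqrt{21(1+\log T)\log\big(3KNT(\lceil\log_2T\rceil+1)\big)}\,\sqrt{KNT}.$$ Moreover, this bound is $\tilde O(\sqrt{KNT})$: there is an absolute constant $C>0$ such that for all $1\le K\le N$, all $T\ge KN(1+K)^4$ and all instances, its right-hand side is at most $C\sqrt{KNT}\,\log(KNT)$. -/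

import Mathlib

open scoped BigOperators

noncomputable section

namespace PosMNL

/-- Feasible decisions `(S, σ)`: an assortment `S` of products together with an injective map
`σ : S → positions`.  The constraint `|S| ≤ K` is automatic, see `Decision.card_le`. -/
abbrev Decision (N K : ℕ) : Type := (S : Finset (Fin N)) × (S ↪ Fin K)

theorem Decision.card_le {N K : ℕ} (d : Decision N K) : d.1.card ≤ K := by
  simpa using Fintype.card_le_of_embedding d.2

/-- The empty assortment is feasible. -/
instance (N K : ℕ) : Inhabited (Decision N K) :=
  ⟨⟨∅, ⟨fun i => absurd i.2 (Finset.notMem_empty _), fun i => absurd i.2 (Finset.notMem_empty _)⟩⟩⟩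

/-- The customer's choice: `none` is the outside option, `some i` the purchase of product `i`. -/
abbrev Choice (N : ℕ) : Type := Option (Fin N)

/-- What is recorded in one round: the decision offered and the customer's choice. -/
abbrev Round (N K : ℕ) : Type := Decision N K × Choice N

/-- The total attraction `∑_{i ∈ S} α_{i, σ(i)}` of a decision. -/
def totalAttraction {N K : ℕ} (α : Fin N → Fin K → ℝ) (d : Decision N K) : ℝ :=
  ∑ i : d.1, α i (d.2 i)

/-- The multinomial logit choice probability; a product that is not offered has probability `0`. -/
def choiceProb {N K : ℕ} (α : Fin N → Fin K → ℝ) (d : Decision N K) : Choice N → ℝ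
  | none => 1 / (1 + totalAttraction α d)
  | some i => if h : i ∈ d.1 then α i (d.2 ⟨i, h⟩) / (1 + totalAttraction α d) else 0

/-- The expected revenue `R(S, σ; α) = ∑_{i ∈ S} r_i P(i | S, σ)`. -/
def revenue {N K : ℕ} (r : Fin N → ℝ) (α : Fin N → Fin K → ℝ) (d : Decision N K) : ℝ :=
  ∑ i ∈ d.1, r i * choiceProb α d (some i)

/-- An instance of the general position effects model with `N` products and `K` positions:
an arbitrary attraction in `(0, 1]` for each product-position pair, and revenues in `[0, 1]`. -/
structure Model (N K : ℕ) where
  v : Fin N → Fin K → ℝ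
  v_pos : ∀ i k, 0 < v i k
  v_le_one : ∀ i k, v i k ≤ 1
  r : Fin N → ℝ
  r_nonneg : ∀ i, 0 ≤ r i
  r_le_one : ∀ i, r i ≤ 1

theorem Model.totalAttraction_nonneg {N K : ℕ} (M : Model N K) (d : Decision N K) :
    0 ≤ totalAttraction M.v d :=
  Finset.sum_nonneg fun i _ => (M.v_pos i (d.2 i)).le

theorem Model.choiceProb_nonneg {N K : ℕ} (M : Model N K) (d : Decision N K) (c : Choice N) :
    0 ≤ choiceProb M.v d c := by
  have h0 := M.totalAttraction_nonneg d
  cases c with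
  | none => simp only [choiceProb]; positivity
  | some i =>
    simp only [choiceProb]
    split_ifs with h
    · exact div_nonneg (M.v_pos _ _).le (by linarith)
    · exact le_rfl

theorem Model.sum_choiceProb {N K : ℕ} (M : Model N K) (d : Decision N K) :
    ∑ c, choiceProb M.v d c = 1 := by
  have h0 := M.totalAttraction_nonneg d
  have h1 : ∑ i : Fin N, choiceProb M.v d (some i)
      = totalAttraction M.v d / (1 + totalAttraction M.v d) := by
    have h2 : ∑ i : Fin N, choiceProb M.v d (some i) = ∑ i ∈ d.1, choiceProb M.v d (some i) := by
      refine (Finset.sum_subset (Finset.subset_univ _) fun i _ hi => ?_).symm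
      simp [choiceProb, hi]
    rw [h2, ← Finset.sum_coe_sort]
    conv_rhs => rw [totalAttraction, Finset.sum_div]
    refine Finset.sum_congr rfl fun i _ => ?_
    simp [choiceProb, totalAttraction]
  rw [Fintype.sum_option, h1]
  simp only [choiceProb]
  field_simp

/-- The law of the customer's choice when `d` is offered. -/
def Model.choiceLaw {N K : ℕ} (M : Model N K) (d : Decision N K) : PMF (Choice N) :=
  PMF.ofFintype (fun c => ENNReal.ofReal (choiceProb M.v d c)) (by
    rw [← ENNReal.ofReal_sum_of_nonneg fun c _ => M.choiceProb_nonneg d c, M.sum_choiceProb,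
      ENNReal.ofReal_one])

/-- The optimal expected revenue `max_{(S, σ)} R(S, σ)` under the true attractions. -/
def Model.optRevenue {N K : ℕ} (M : Model N K) : ℝ :=
  Finset.univ.sup' Finset.univ_nonempty fun d : Decision N K => revenue M.r M.v d

/-- `V_max`: the maximum total attraction of a feasible decision. -/
def Model.Vmax {N K : ℕ} (M : Model N K) : ℝ :=
  Finset.univ.sup' Finset.univ_nonempty fun d : Decision N K => totalAttraction M.v d

/-- The observations of the first `t` rounds. -/
abbrev History (N K t : ℕ) : Type := Fin t → Round N K

/-- A (possibly randomized) admissible policy: given the observations of the first `t` rounds, the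
law of the decision offered in the next round. -/
abbrev Policy (N K : ℕ) : Type := (t : ℕ) → History N K t → PMF (Decision N K)

/-- The joint law of the first `t` rounds when policy `π` interacts with the model `M`. -/
def Model.historyLaw {N K : ℕ} (M : Model N K) (π : Policy N K) :
    (t : ℕ) → PMF (History N K t)
  | 0 => PMF.pure Fin.elim0
  | t + 1 => (M.historyLaw π t).bind fun h => (π t h).bind fun d =>
      (M.choiceLaw d).map fun c => Fin.snoc (α := fun _ => Round N K) h (d, c)

/-- The expected cumulative regret of `π` over `T` rounds. The expectation is a finite sum, as there
are finitely many histories of length `T`. -/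
def Model.regret {N K : ℕ} (M : Model N K) (π : Policy N K) (T : ℕ) : ℝ :=
  ∑ h : History N K T, (M.historyLaw π T h).toReal *
    ∑ s : Fin T, (M.optRevenue - revenue M.r M.v (h s).1)

/-- Product `i` is offered, and it is displayed at position `k`. -/
def Decision.Displays {N K : ℕ} (d : Decision N K) (i : Fin N) (k : Fin K) : Prop :=
  ∃ hi : i ∈ d.1, d.2 ⟨i, hi⟩ = k

open Classical in
/-- `n_{i,k}`: the number of past rounds in which `i` was displayed at `k` and the customer
purchased `i` or left without a purchase. -/
def pairCount {N K t : ℕ} (h : History N K t) (i : Fin N) (k : Fin K) : ℕ :=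
  (Finset.univ.filter fun s : Fin t =>
    ((h s).2 = some i ∨ (h s).2 = none) ∧ Decision.Displays (h s).1 i k).card

open Classical in
/-- `w_{i,k}`: the number of past rounds in which `i` was displayed at `k` and purchased. -/
def winCount {N K t : ℕ} (h : History N K t) (i : Fin N) (k : Fin K) : ℕ :=
  (Finset.univ.filter fun s : Fin t =>
    (h s).2 = some i ∧ Decision.Displays (h s).1 i k).card

/-- The confidence parameter `δ = 2 / (3KNT)`. -/
def confDelta (N K T : ℕ) : ℝ := 2 / (3 * K * N * T)

/-- `L = log (2 (⌈log₂ T⌉ + 1) / δ)`. -/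
def confL (N K T : ℕ) : ℝ :=
  Real.log (2 * ((⌈Real.logb 2 T⌉₊ : ℝ) + 1) / confDelta N K T)

/-- The empirical pairwise success probability `w_{i,k} / n_{i,k}`. -/
def pHat {N K t : ℕ} (h : History N K t) (i : Fin N) (k : Fin K) : ℝ :=
  (winCount h i k : ℝ) / pairCount h i k

/-- The Bernstein-type upper confidence bound on the pairwise success probability. -/
def pUcb {N K t : ℕ} (T : ℕ) (h : History N K t) (i : Fin N) (k : Fin K) : ℝ :=
  min (pHat h i k + 2 * √(pHat h i k * (1 - pHat h i k) * confL N K T / pairCount h i k)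
    + 6 * confL N K T / pairCount h i k) (1 / 2)

/-- The upper confidence bound on the attraction of the pair `(i, k)`. -/
def vUcb {N K t : ℕ} (T : ℕ) (h : History N K t) (i : Fin N) (k : Fin K) : ℝ :=
  if 0 < pairCount h i k then pUcb T h i k / (1 - pUcb T h i k) else 1

/-- `π` is an implementation of GP2-UCB for revenues `r` and horizon `T`: in each of the `T` rounds
it offers a maximizer of the expected revenue under the optimistic attractions. Ties may be broken
in any way, also at random or depending on the history. -/
def IsGP2UCB {N K : ℕ} (r : Fin N → ℝ) (T : ℕ) (π : Policy N K) : Prop :=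
  ∀ t < T, ∀ h : History N K t, ∀ d ∈ (π t h).support, ∀ d' : Decision N K,
    revenue r (vUcb T h) d' ≤ revenue r (vUcb T h) d

/-- The explicit regret bound, as a function of `N`, `K`, `T` and `V = V_max`. -/
def regretBound (N K T : ℕ) (V : ℝ) : ℝ :=
  1 + K * N * max (2 * Real.log (3 * K * N * T ^ 2) * (1 + V) ^ 2)
      (160 * Real.log (3 * K * N * T * ((⌈Real.logb 2 T⌉₊ : ℝ) + 1)) * (1 + K) ^ 2)
    + 4 * √(21 * (1 + Real.log T) *
        Real.log (3 * K * N * T * ((⌈Real.logb 2 T⌉₊ : ℝ) + 1))) * √(K * N * T)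

end PosMNL

end

open PosMNL

namespace PosMNL

/-! ### Expectations over histories -/

/-! Given that the customer facing `i` at `k` either buys `i` or leaves, the purchase is a Bernoulli
trial with success probability `p = v/(1+v)`, whatever else is displayed. Each pair can therefore be
estimated on its own. A Bernstein bound makes every `vUcb` an upper bound, except with probability
at most `2KNT·exp(-2L)` in each round. The revenue of a fixed decision is not monotone in the
attractions, but the maximal revenue is, so off this event the loss of a round is at most the
optimistic overshoot of the decision offered. With `A` the total attraction of that decision, the
overshoot is at most twice the sum over displayed pairs of `(1+v)/(1+A) * confWidth`
(`Model.optRevenue_sub_le`).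

The factor `(1+v)/(1+A)` is exactly the probability that the round adds an observation of the pair.
The charged width is thus the mean increase of the potential `widthSum p L n`, and regret minus
twice the total potential drifts upwards only through failures
(`Model.expect_regret_sub_widthSum_le`). No lower bound on the observation counts is needed.

The potential of a pair is of order `√(L p n) + L log T`, and the mean of `∑ p n` is at most `T`
(`Model.expect_sum_pairProb_mul_pairCount_le`). Cauchy-Schwarz, in AM-GM form, yields `√(L·KNT)`
plus a remainder of order `L·KN·log T`. The remainder is absorbed by comparison with the trivial
bound `T` on the regret, so the term in `V_max` is never used. -/

theorem sum_bind_toReal {α β : Type*} [Fintype α] [Fintype β] (p : PMF α) (q : α → PMF β)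
    (f : β → ℝ) :
    ∑ b, (p.bind q b).toReal * f b = ∑ a, (p a).toReal * ∑ b, (q a b).toReal * f b := by
  have h : ∀ b, (p.bind q b).toReal = ∑ a, (p a).toReal * (q a b).toReal := fun b => by
    rw [PMF.bind_apply, tsum_fintype, ENNReal.toReal_sum]
    · simp [ENNReal.toReal_mul]
    · intro a _
      exact ENNReal.mul_ne_top (PMF.apply_ne_top _ _) (PMF.apply_ne_top _ _)
  simp_rw [h, Finset.sum_mul, Finset.mul_sum]
  rw [Finset.sum_comm]
  simp_rw [mul_assoc]

theorem sum_pure_toReal {β : Type*} [Fintype β] (b : β) (f : β → ℝ) :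
    ∑ b', (PMF.pure b b').toReal * f b' = f b := by
  classical
  rw [Finset.sum_eq_single b]
  · simp
  · intro b' _ hb; simp [PMF.pure_apply, hb]
  · simp

theorem sum_map_toReal {α β : Type*} [Fintype α] [Fintype β] (p : PMF α) (g : α → β)
    (f : β → ℝ) : ∑ b, (p.map g b).toReal * f b = ∑ a, (p a).toReal * f (g a) := by
  rw [PMF.map, sum_bind_toReal]
  simp only [Function.comp_apply, sum_pure_toReal]

theorem sum_toReal_eq_one {α : Type*} [Fintype α] (p : PMF α) : ∑ a, (p a).toReal = 1 := by
  rw [← ENNReal.toReal_sum fun a _ => p.apply_ne_top a, ← tsum_fintype (L := .unconditional _),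
    p.tsum_coe, ENNReal.toReal_one]

/-- The expectation of a function of the first `t` rounds. -/
noncomputable def Model.expect {N K : ℕ} (M : Model N K) (π : Policy N K) (t : ℕ)
    (f : History N K t → ℝ) : ℝ :=
  ∑ h, (M.historyLaw π t h).toReal * f h

/-- The mean of a function of the decision and the choice made after the history `h`. -/
noncomputable def Model.roundMean {N K t : ℕ} (M : Model N K) (π : Policy N K) (h : History N K t)
    (g : Decision N K → Choice N → ℝ) : ℝ :=
  ∑ d, (π t h d).toReal * ∑ c, choiceProb M.v d c * g d c

variable {N K : ℕ}

theorem Model.expect_zero (M : Model N K) (π : Policy N K) (f : History N K 0 → ℝ) :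
    M.expect π 0 f = f Fin.elim0 :=
  sum_pure_toReal _ _

theorem Model.choiceLaw_toReal (M : Model N K) (d : Decision N K) (c : Choice N) :
    (M.choiceLaw d c).toReal = choiceProb M.v d c := by
  simp [Model.choiceLaw, ENNReal.toReal_ofReal (M.choiceProb_nonneg d c)]

theorem Model.expect_succ (M : Model N K) (π : Policy N K) (t : ℕ)
    (f : History N K (t + 1) → ℝ) :
    M.expect π (t + 1) f = M.expect π t fun h => M.roundMean π h fun d c =>
      f (Fin.snoc (α := fun _ => Round N K) h (d, c)) := by
  simp only [Model.expect, Model.historyLaw, Model.roundMean]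
  simp_rw [sum_bind_toReal, sum_map_toReal, Model.choiceLaw_toReal]

theorem Model.expect_mono (M : Model N K) (π : Policy N K) (t : ℕ) {f g : History N K t → ℝ}
    (h : ∀ x, f x ≤ g x) : M.expect π t f ≤ M.expect π t g :=
  Finset.sum_le_sum fun x _ => mul_le_mul_of_nonneg_left (h x) ENNReal.toReal_nonneg

theorem Model.expect_const (M : Model N K) (π : Policy N K) (t : ℕ) (a : ℝ) :
    M.expect π t (fun _ => a) = a := by
  rw [Model.expect, ← Finset.sum_mul, sum_toReal_eq_one, one_mul]

theorem Model.expect_add (M : Model N K) (π : Policy N K) (t : ℕ) (f g : History N K t → ℝ) :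
    M.expect π t (fun h => f h + g h) = M.expect π t f + M.expect π t g := by
  simp only [Model.expect, mul_add, Finset.sum_add_distrib]

theorem Model.expect_mul_left (M : Model N K) (π : Policy N K) (t : ℕ) (a : ℝ)
    (f : History N K t → ℝ) : M.expect π t (fun h => a * f h) = a * M.expect π t f := by
  simp only [Model.expect, Finset.mul_sum, mul_left_comm]

theorem Model.expect_sum {ι : Type*} (s : Finset ι) (M : Model N K) (π : Policy N K) (t : ℕ)
    (f : ι → History N K t → ℝ) :
    M.expect π t (fun h => ∑ i ∈ s, f i h) = ∑ i ∈ s, M.expect π t (f i) := by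
  simp only [Model.expect, Finset.mul_sum]
  exact Finset.sum_comm

theorem Model.roundMean_le {t : ℕ} (M : Model N K) (π : Policy N K) (h : History N K t)
    {g : Decision N K → Choice N → ℝ} {b : ℝ}
    (hb : ∀ d ∈ (π t h).support, ∑ c, choiceProb M.v d c * g d c ≤ b) :
    M.roundMean π h g ≤ b := by
  calc M.roundMean π h g ≤ ∑ d, (π t h d).toReal * b := by
        refine Finset.sum_le_sum fun d _ => ?_
        by_cases hd : d ∈ (π t h).support
        · exact mul_le_mul_of_nonneg_left (hb d hd) ENNReal.toReal_nonneg
        · rw [PMF.mem_support_iff, not_not] at hd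
          simp [hd]
    _ = b := by rw [← Finset.sum_mul, sum_toReal_eq_one, one_mul]

/-! ### One round -/

/-- Purchases of products other than `i` leave the counts of `(i, k)` unchanged, so functions of
these counts take one baseline value `b` there. -/
theorem Model.sum_choiceProb_mul (M : Model N K) (d : Decision N K) (i : Fin N)
    (g : Choice N → ℝ) (b : ℝ) (hg : ∀ j, j ≠ i → g (some j) = b) :
    ∑ c, choiceProb M.v d c * g c
      = b + choiceProb M.v d none * (g none - b) + choiceProb M.v d (some i) * (g (some i) - b) := by
  have h1 : ∑ c, choiceProb M.v d c * (g c - b)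
      = choiceProb M.v d none * (g none - b) + choiceProb M.v d (some i) * (g (some i) - b) := by
    rw [Fintype.sum_option, Finset.sum_eq_single i]
    · intro j _ hj
      rw [hg j hj, sub_self, mul_zero]
    · simp
  have h2 : ∑ c, choiceProb M.v d c * (g c - b) = ∑ c, choiceProb M.v d c * g c - b := by
    simp only [mul_sub, Finset.sum_sub_distrib]
    rw [← Finset.sum_mul, M.sum_choiceProb, one_mul]
  linarith

theorem choiceProb_of_displays {α : Fin N → Fin K → ℝ} {d : Decision N K} {i : Fin N} {k : Fin K}
    (h : d.Displays i k) : choiceProb α d (some i) = α i k / (1 + totalAttraction α d) := by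
  obtain ⟨hi, rfl⟩ := h
  simp [choiceProb, hi]

theorem sum_offered (d : Decision N K) (f : Fin N → Fin K → ℝ) :
    ∑ j : d.1, f j (d.2 j) = ∑ i, if hi : i ∈ d.1 then f i (d.2 ⟨i, hi⟩) else 0 := by
  have h : ∑ i ∈ d.1, (if hi : i ∈ d.1 then f i (d.2 ⟨i, hi⟩) else 0)
      = ∑ i, (if hi : i ∈ d.1 then f i (d.2 ⟨i, hi⟩) else 0) :=
    Finset.sum_subset (Finset.subset_univ _) fun i _ hi => by simp [hi]
  rw [← h]
  exact (Finset.sum_congr rfl fun j _ => by simp).trans (Finset.sum_coe_sort d.1 _)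

open Classical in
theorem sum_displays (d : Decision N K) (f : Fin N → Fin K → ℝ) :
    ∑ i, ∑ k, (if d.Displays i k then f i k else 0) = ∑ j : d.1, f j (d.2 j) := by
  rw [sum_offered]
  refine Finset.sum_congr rfl fun i _ => ?_
  split_ifs with hi
  · rw [Finset.sum_eq_single (d.2 ⟨i, hi⟩)]
    · simp [Decision.Displays, hi]
    · intro k _ hk
      rw [if_neg]
      rintro ⟨_, rfl⟩
      exact hk rfl
    · simp
  · refine Finset.sum_eq_zero fun k _ => if_neg ?_
    rintro ⟨h, _⟩
    exact hi h

open Classical in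
theorem pairCount_snoc {t : ℕ} (h : History N K t) (d : Decision N K) (c : Choice N) (i : Fin N)
    (k : Fin K) :
    pairCount (Fin.snoc (α := fun _ => Round N K) h (d, c) : History N K (t + 1)) i k
      = pairCount h i k + if (c = some i ∨ c = none) ∧ d.Displays i k then 1 else 0 := by
  simp only [pairCount, Finset.card_filter, Fin.sum_univ_castSucc, Fin.snoc_castSucc,
    Fin.snoc_last]

open Classical in
theorem winCount_snoc {t : ℕ} (h : History N K t) (d : Decision N K) (c : Choice N) (i : Fin N)
    (k : Fin K) :
    winCount (Fin.snoc (α := fun _ => Round N K) h (d, c) : History N K (t + 1)) i k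
      = winCount h i k + if c = some i ∧ d.Displays i k then 1 else 0 := by
  simp only [winCount, Finset.card_filter, Fin.sum_univ_castSucc, Fin.snoc_castSucc,
    Fin.snoc_last]

theorem pairCount_le {t : ℕ} (h : History N K t) (i : Fin N) (k : Fin K) : pairCount h i k ≤ t := by
  rw [pairCount]
  exact (Finset.card_le_univ _).trans (by simp)

theorem winCount_le_pairCount {t : ℕ} (h : History N K t) (i : Fin N) (k : Fin K) :
    winCount h i k ≤ pairCount h i k := by
  unfold winCount pairCount
  refine Finset.card_le_card fun s => ?_
  simp only [Finset.mem_filter]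
  tauto

open Classical in
/-- The mean of a function of the pair count after one more round. -/
theorem Model.sum_choiceProb_pairCount_snoc {t : ℕ} (M : Model N K) (h : History N K t)
    (d : Decision N K) (i : Fin N) (k : Fin K) (Φ : ℕ → ℝ) :
    ∑ c, choiceProb M.v d c *
        Φ (pairCount (Fin.snoc (α := fun _ => Round N K) h (d, c) : History N K (t + 1)) i k)
      = Φ (pairCount h i k) + if d.Displays i k then
          (1 + M.v i k) / (1 + totalAttraction M.v d) *
            (Φ (pairCount h i k + 1) - Φ (pairCount h i k)) else 0 := by
  rw [M.sum_choiceProb_mul d i _ (Φ (pairCount h i k))]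
  · by_cases hd : d.Displays i k
    · simp only [pairCount_snoc, hd, choiceProb_of_displays hd]
      simp only [choiceProb, reduceCtorEq, or_true, and_self, if_true, true_or]
      ring
    · simp [pairCount_snoc, hd]
  · intro j hj
    rw [pairCount_snoc, if_neg, add_zero]
    simp [hj]

/-! ### Concentration of the pairwise success counts -/

theorem exp_le_quadratic_of_nonpos {y : ℝ} (hy : y ≤ 0) :
    Real.exp y ≤ 1 + y + y ^ 2 / 2 := by
  have hd : ∀ x : ℝ, HasDerivAt (fun x => 1 + x + x ^ 2 / 2 - Real.exp x) (1 + x - Real.exp x) x :=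
    fun x => by
      have := (((hasDerivAt_id x).const_add 1).add (((hasDerivAt_id x).pow 2).div_const 2)).sub
        (Real.hasDerivAt_exp x)
      exact this.congr_deriv (by simp)
  have hanti : Antitone fun x : ℝ => 1 + x + x ^ 2 / 2 - Real.exp x :=
    antitone_of_hasDerivAt_nonpos hd fun x => by
      have := Real.add_one_le_exp x
      show 1 + x - Real.exp x ≤ 0
      linarith
  have := hanti hy
  simp at this
  linarith

/-- This is the Padé bound `exp y ≤ (2 + y)/(2 - y)` cleared of its denominator, so that the
division by `2 - y` can wait until `y < 2` is known. -/
theorem two_sub_mul_exp_le {y : ℝ} (hy : 0 ≤ y) : (2 - y) * Real.exp y ≤ 2 + y := by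
  have hd : ∀ x : ℝ, HasDerivAt (fun x => (2 - x) * Real.exp x - (2 + x))
      ((1 - x) * Real.exp x - 1) x := fun x => by
    have := (((hasDerivAt_id x).const_sub 2).mul (Real.hasDerivAt_exp x)).sub
      ((hasDerivAt_id x).const_add 2)
    exact this.congr_deriv (by simp; ring)
  have hanti : Antitone fun x : ℝ => (2 - x) * Real.exp x - (2 + x) :=
    antitone_of_hasDerivAt_nonpos hd fun x => by
      have h1 := Real.one_sub_le_exp_neg x
      have h2 := mul_le_mul_of_nonneg_right h1 (Real.exp_pos x).le
      rw [← Real.exp_add] at h2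
      simp at h2
      show (1 - x) * Real.exp x - 1 ≤ 0
      linarith
  have := hanti hy
  simp at this
  linarith

theorem exp_le_quadratic {y l : ℝ} (hy : |y| ≤ l) (hl : l < 2) :
    Real.exp y ≤ 1 + y + y ^ 2 / (2 - l) := by
  have hl0 : 0 ≤ l := (abs_nonneg y).trans hy
  rcases le_total y 0 with h | h
  · refine (exp_le_quadratic_of_nonpos h).trans ?_
    have : y ^ 2 / 2 ≤ y ^ 2 / (2 - l) :=
      div_le_div_of_nonneg_left (sq_nonneg y) (by linarith) (by linarith)
    linarith
  · rw [abs_of_nonneg h] at hy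
    have h1 : Real.exp y ≤ (2 + y) / (2 - y) := by
      rw [le_div_iff₀ (by linarith), mul_comm]
      exact two_sub_mul_exp_le h
    have h2 : (2 + y) / (2 - y) = 1 + y + y ^ 2 / (2 - y) := by
      have : 2 - y ≠ 0 := by linarith
      field_simp
      ring
    have h3 : y ^ 2 / (2 - y) ≤ y ^ 2 / (2 - l) :=
      div_le_div_of_nonneg_left (sq_nonneg y) (by linarith) (by linarith)
    linarith

/-- The linear terms of the quadratic bounds cancel by centering, and the squares average to the
variance `p(1-p)`. The denominator `2 - |θ|` is the sub-gamma form that produces Bernstein tails. -/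
theorem bernoulli_mgf_le {p θ : ℝ} (h0 : 0 ≤ p) (h1 : p ≤ 1) (hθ : |θ| < 2) :
    p * Real.exp (θ * (1 - p)) + (1 - p) * Real.exp (-(θ * p))
      ≤ Real.exp (p * (1 - p) * θ ^ 2 / (2 - |θ|)) := by
  have e1 := exp_le_quadratic (y := θ * (1 - p)) (l := |θ|) (by
    rw [abs_mul, abs_of_nonneg (sub_nonneg.2 h1)]
    exact mul_le_of_le_one_right (abs_nonneg θ) (by linarith)) hθ
  have e2 := exp_le_quadratic (y := -(θ * p)) (l := |θ|) (by
    rw [abs_neg, abs_mul, abs_of_nonneg h0]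
    exact mul_le_of_le_one_right (abs_nonneg θ) h1) hθ
  have e3 := mul_le_mul_of_nonneg_left e1 h0
  have e4 := mul_le_mul_of_nonneg_left e2 (sub_nonneg.2 h1)
  have e5 := Real.add_one_le_exp (p * (1 - p) * θ ^ 2 / (2 - |θ|))
  have e6 : p * (1 + θ * (1 - p) + (θ * (1 - p)) ^ 2 / (2 - |θ|))
      + (1 - p) * (1 + -(θ * p) + (-(θ * p)) ^ 2 / (2 - |θ|))
      = p * (1 - p) * θ ^ 2 / (2 - |θ|) + 1 := by ring
  linarith

/-- The probability that product `i` at position `k` is preferred to the outside option. -/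
noncomputable def Model.pairProb (M : Model N K) (i : Fin N) (k : Fin K) : ℝ :=
  M.v i k / (1 + M.v i k)

theorem Model.pairProb_pos (M : Model N K) (i : Fin N) (k : Fin K) : 0 < M.pairProb i k := by
  have := M.v_pos i k
  unfold Model.pairProb
  positivity

theorem Model.pairProb_le_half (M : Model N K) (i : Fin N) (k : Fin K) :
    M.pairProb i k ≤ 1 / 2 := by
  have := M.v_pos i k
  have := M.v_le_one i k
  unfold Model.pairProb
  rw [div_le_div_iff₀ (by linarith) (by norm_num)]
  linarith

-- An exponential supermartingale: the exponent moves only when the round is a trial for `(i, k)`,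
-- and then `bernoulli_mgf_le` shows that the mean factor is at most one.
open Classical in
theorem Model.expect_exp_le_one (M : Model N K) (π : Policy N K) (i : Fin N) (k : Fin K) {θ : ℝ}
    (hθ : |θ| < 2) (t : ℕ) :
    M.expect π t (fun h => Real.exp (θ * (winCount h i k - M.pairProb i k * pairCount h i k)
      - M.pairProb i k * (1 - M.pairProb i k) * θ ^ 2 / (2 - |θ|) * pairCount h i k)) ≤ 1 := by
  set p := M.pairProb i k with hp
  set ψ := p * (1 - p) * θ ^ 2 / (2 - |θ|) with hψ
  have hmgf := bernoulli_mgf_le (M.pairProb_pos i k).le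
    ((M.pairProb_le_half i k).trans (by norm_num)) hθ
  rw [← hp, ← hψ] at hmgf
  induction t with
  | zero =>
    rw [Model.expect_zero]
    simp [winCount, pairCount]
  | succ t ih =>
    rw [Model.expect_succ]
    refine le_trans (M.expect_mono π t fun h => M.roundMean_le π h fun d _ => ?_) ih
    set x := Real.exp (θ * (winCount h i k - p * pairCount h i k) - ψ * pairCount h i k) with hx
    rw [M.sum_choiceProb_mul d i _ x]
    · by_cases hd : d.Displays i k
      · have hA := M.totalAttraction_nonneg d
        have hv := M.v_pos i k
        have hx0 : 0 < x := Real.exp_pos _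
        rw [choiceProb_of_displays hd]
        simp only [choiceProb, winCount_snoc, pairCount_snoc, hd, reduceCtorEq, or_true, true_or,
          and_self, if_true, false_and, if_false]
        have ea : Real.exp (θ * (((winCount h i k + 0 : ℕ) : ℝ)
            - p * ((pairCount h i k + 1 : ℕ) : ℝ)) - ψ * ((pairCount h i k + 1 : ℕ) : ℝ))
            = x * (Real.exp (-(θ * p)) / Real.exp ψ) := by
          rw [hx, ← Real.exp_sub, ← Real.exp_add]
          congr 1
          push_cast
          ring
        have eb : Real.exp (θ * (((winCount h i k + 1 : ℕ) : ℝ)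
            - p * ((pairCount h i k + 1 : ℕ) : ℝ)) - ψ * ((pairCount h i k + 1 : ℕ) : ℝ))
            = x * (Real.exp (θ * (1 - p)) / Real.exp ψ) := by
          rw [hx, ← Real.exp_sub, ← Real.exp_add]
          congr 1
          push_cast
          ring
        rw [ea, eb]
        have h1 : p * (Real.exp (θ * (1 - p)) / Real.exp ψ)
            + (1 - p) * (Real.exp (-(θ * p)) / Real.exp ψ) ≤ 1 := by
          rw [mul_div_assoc', mul_div_assoc', ← add_div]
          exact div_le_one_of_le₀ hmgf (Real.exp_pos _).le
        have h2 : 1 / (1 + totalAttraction M.v d)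
            = (1 + M.v i k) / (1 + totalAttraction M.v d) * (1 - p) := by
          rw [hp, Model.pairProb]
          field_simp
          ring
        have h3 : M.v i k / (1 + totalAttraction M.v d)
            = (1 + M.v i k) / (1 + totalAttraction M.v d) * p := by
          rw [hp, Model.pairProb]
          field_simp
        rw [h2, h3]
        have h4 : 0 ≤ (1 + M.v i k) / (1 + totalAttraction M.v d) * x := by positivity
        nlinarith [mul_le_mul_of_nonneg_left h1 h4]
      · simp [winCount_snoc, pairCount_snoc, hd, hx]
    · intro j hj
      simp [winCount_snoc, pairCount_snoc, hj, hx]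

-- Markov's inequality for the exponential supermartingale. Fixing the value `m` of the random count
-- makes the compensator deterministic, so `θ` can be tuned to `m`.
open Classical in
theorem Model.expect_tail_le (M : Model N K) (π : Policy N K) (i : Fin N) (k : Fin K) {s L : ℝ}
    (hs : |s| = 1) (hL : 0 < L) {m : ℕ} (hm : 0 < m) (t : ℕ) :
    M.expect π t (fun h => if pairCount h i k = m ∧
        L + 2 * √(M.pairProb i k * (1 - M.pairProb i k) * m * L)
          < s * (winCount h i k - M.pairProb i k * m) then 1 else 0) ≤ Real.exp (-(2 * L)) := by
  have hp0 := M.pairProb_pos i k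
  have hp1 := M.pairProb_le_half i k
  set p := M.pairProb i k with hp
  set g := √(p * (1 - p) * m * L) with hg
  have hm' : (0 : ℝ) < m := by exact_mod_cast hm
  have hpos : 0 < p * (1 - p) * m * L := by
    have : 0 < 1 - p := by linarith
    positivity
  have hg0 : 0 < g := Real.sqrt_pos.2 hpos
  have hgs : g ^ 2 = p * (1 - p) * m * L := Real.sq_sqrt hpos.le
  set θ := s * (2 * L / (L + g)) with hθ
  have habs : |θ| = 2 * L / (L + g) := by
    rw [hθ, abs_mul, hs, one_mul, abs_of_pos (by positivity)]
  have hθ2 : 2 - |θ| = 2 * g / (L + g) := by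
    rw [habs]
    field_simp
    ring
  have hlt : |θ| < 2 := by
    have : 0 < 2 * g / (L + g) := by positivity
    linarith
  have hψ : p * (1 - p) * θ ^ 2 / (2 - |θ|) * m = 2 * L * g / (L + g) := by
    rw [hθ2, ← sq_abs θ, habs]
    have : p * (1 - p) * m = g ^ 2 / L := by rw [hgs]; field_simp
    calc _ = (p * (1 - p) * m) * ((2 * L / (L + g)) ^ 2 / (2 * g / (L + g))) := by ring
      _ = _ := by
        rw [this]
        field_simp
  have key := M.expect_exp_le_one π i k hlt t
  rw [← hp] at key
  refine le_trans (M.expect_mono π t (g := fun h => Real.exp (-(2 * L)) *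
    Real.exp (θ * (winCount h i k - p * pairCount h i k)
      - p * (1 - p) * θ ^ 2 / (2 - |θ|) * pairCount h i k)) fun h => ?_) ?_
  · split_ifs with hh
    · obtain ⟨hn, hdev⟩ := hh
      rw [hn, hψ, ← Real.exp_add]
      apply Real.one_le_exp
      have h1 : 2 * L / (L + g) * (L + 2 * g)
          ≤ 2 * L / (L + g) * (s * (winCount h i k - p * m)) :=
        mul_le_mul_of_nonneg_left hdev.le (by positivity)
      have h2 : 2 * L / (L + g) * (L + 2 * g) = 2 * L + 2 * L * g / (L + g) := by
        field_simp
        ring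
      have h3 : θ * (winCount h i k - p * m)
          = 2 * L / (L + g) * (s * (winCount h i k - p * m)) := by rw [hθ]; ring
      linarith
    · positivity
  · rw [M.expect_mul_left]
    exact mul_le_of_le_one_right (Real.exp_pos _).le key

/-- The empirical success count of the pair `(i, k)` is further from its mean than the Bernstein
radius. -/
def Model.Deviates {t : ℕ} (M : Model N K) (L : ℝ) (h : History N K t) (i : Fin N) (k : Fin K) :
    Prop :=
  0 < pairCount h i k ∧
    L + 2 * √(M.pairProb i k * (1 - M.pairProb i k) * pairCount h i k * L)
      < |(winCount h i k : ℝ) - M.pairProb i k * pairCount h i k|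

-- Union bound over pairs, over the two signs, and over the at most `T` positive values of the
-- count.
open Classical in
theorem Model.expect_deviates_le (M : Model N K) (π : Policy N K) {L : ℝ} (hL : 0 < L) {t T : ℕ}
    (ht : t ≤ T) :
    M.expect π t (fun h => if ∃ i k, M.Deviates L h i k then 1 else 0)
      ≤ 2 * (K * N * T) * Real.exp (-(2 * L)) := by
  let F : Fin N → Fin K → ℕ → ℝ → History N K t → ℝ := fun i k m s h =>
    if pairCount h i k = m ∧ L + 2 * √(M.pairProb i k * (1 - M.pairProb i k) * m * L)
      < s * (winCount h i k - M.pairProb i k * m) then 1 else 0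
  have hF0 : ∀ i k m s h, 0 ≤ F i k m s h := fun i k m s h => by
    simp only [F]
    split_ifs <;> norm_num
  have hterm0 : ∀ h i k m, 0 ≤ F i k m 1 h + F i k m (-1) h :=
    fun h i k m => add_nonneg (hF0 ..) (hF0 ..)
  calc M.expect π t (fun h => if ∃ i k, M.Deviates L h i k then 1 else 0)
      ≤ M.expect π t (fun h => ∑ i, ∑ k, ∑ m ∈ Finset.Icc 1 T,
          (F i k m 1 h + F i k m (-1) h)) := by
        refine M.expect_mono π t fun h => ?_
        split_ifs with hh
        · obtain ⟨i, k, hn, hdev⟩ := hh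
          have h1 : 1 ≤ F i k (pairCount h i k) 1 h + F i k (pairCount h i k) (-1) h := by
            rcases lt_abs.1 hdev with h' | h'
            · have : F i k (pairCount h i k) 1 h = 1 := if_pos ⟨rfl, by simpa using h'⟩
              linarith [hF0 i k (pairCount h i k) (-1) h]
            · have : F i k (pairCount h i k) (-1) h = 1 :=
                if_pos ⟨rfl, h'.trans_eq (by ring)⟩
              linarith [hF0 i k (pairCount h i k) 1 h]
          refine h1.trans ?_
          refine le_trans ?_ (Finset.single_le_sum (f := fun i => ∑ k, ∑ m ∈ Finset.Icc 1 T,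
            (F i k m 1 h + F i k m (-1) h)) (fun i _ => Finset.sum_nonneg fun k _ =>
              Finset.sum_nonneg fun m _ => hterm0 h i k m) (Finset.mem_univ i))
          refine le_trans ?_ (Finset.single_le_sum (f := fun k => ∑ m ∈ Finset.Icc 1 T,
            (F i k m 1 h + F i k m (-1) h)) (fun k _ =>
              Finset.sum_nonneg fun m _ => hterm0 h i k m) (Finset.mem_univ k))
          exact Finset.single_le_sum (f := fun m => F i k m 1 h + F i k m (-1) h)
            (fun m _ => hterm0 h i k m)
            (Finset.mem_Icc.2 ⟨hn, (pairCount_le h i k).trans ht⟩)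
        · exact Finset.sum_nonneg fun i _ => Finset.sum_nonneg fun k _ =>
            Finset.sum_nonneg fun m _ => hterm0 h i k m
    _ = ∑ i, ∑ k, ∑ m ∈ Finset.Icc 1 T,
          (M.expect π t (F i k m 1) + M.expect π t (F i k m (-1))) := by
        simp only [Model.expect_sum, Model.expect_add]
    _ ≤ ∑ _i : Fin N, ∑ _k : Fin K, ∑ _m ∈ Finset.Icc 1 T,
          (Real.exp (-(2 * L)) + Real.exp (-(2 * L))) := by
        refine Finset.sum_le_sum fun i _ => Finset.sum_le_sum fun k _ =>
          Finset.sum_le_sum fun m hm => ?_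
        have hm := (Finset.mem_Icc.1 hm).1
        exact add_le_add (M.expect_tail_le π i k (by simp) hL hm t)
          (M.expect_tail_le π i k (by simp) hL hm t)
    _ = 2 * (K * N * T) * Real.exp (-(2 * L)) := by
        simp
        ring

/-! ### The upper confidence bounds -/

/-- The true variance is traded for the empirical one through `p(1-p) ≤ q(1-q) + (p-q)` when `p ≥
q`. A gap `D = p - q` above `2s + 6l` would then contradict the resulting inequality `D(D - 6l) ≤
4s² - l²`. -/
theorem le_bernstein_ucb {p q l : ℝ} (hp0 : 0 ≤ p) (hp1 : p ≤ 1) (hq0 : 0 ≤ q) (hq1 : q ≤ 1)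
    (hl : 0 < l) (h : p - q ≤ l + 2 * √(p * (1 - p) * l)) :
    p ≤ q + 2 * √(q * (1 - q) * l) + 6 * l := by
  by_contra! hlt
  have hs := Real.sqrt_nonneg (q * (1 - q) * l)
  have hs2 : √(q * (1 - q) * l) ^ 2 = q * (1 - q) * l :=
    Real.sq_sqrt (mul_nonneg (mul_nonneg hq0 (sub_nonneg.2 hq1)) hl.le)
  have hg2 : √(p * (1 - p) * l) ^ 2 = p * (1 - p) * l :=
    Real.sq_sqrt (mul_nonneg (mul_nonneg hp0 (by linarith)) hl.le)
  set s := √(q * (1 - q) * l)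
  set g := √(p * (1 - p) * l)
  have hD : 2 * s + 6 * l < p - q := by linarith
  have h1 : (p - q - l) ^ 2 ≤ (2 * g) ^ 2 := pow_le_pow_left₀ (by linarith) (by linarith) 2
  have h2 : p * (1 - p) * l ≤ q * (1 - q) * l + (p - q) * l := by
    have : 0 ≤ (p - q) * (p + q) * l := by
      have : 0 ≤ p - q := by linarith
      positivity
    nlinarith
  have h3 : (2 * s + 6 * l) * (2 * s) ≤ (p - q) * (p - q - 6 * l) :=
    mul_le_mul hD.le (by linarith) (by linarith) (by linarith)
  nlinarith [mul_nonneg hs hl.le, mul_pos hl hl]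

/-- Completing the square gives `q l ≤ (√(pl) + l)²`, so the empirical radius is at most `√(pl) +
l`. -/
theorem bernstein_ucb_le {p q l : ℝ} (hp0 : 0 ≤ p) (hq0 : 0 ≤ q)
    (hl : 0 < l) (h : q - p ≤ l + 2 * √(p * (1 - p) * l)) :
    q + 2 * √(q * (1 - q) * l) + 6 * l ≤ p + (4 * √(p * l) + 9 * l) := by
  have h1 : √(p * (1 - p) * l) ≤ √(p * l) := by
    refine Real.sqrt_le_sqrt (mul_le_mul_of_nonneg_right ?_ hl.le)
    exact mul_le_of_le_one_right hp0 (by linarith)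
  have ha2 := Real.sq_sqrt (mul_nonneg hp0 hl.le)
  have ha0 := Real.sqrt_nonneg (p * l)
  have h2 : √(q * (1 - q) * l) ≤ √(p * l) + l := by
    refine Real.sqrt_le_iff.2 ⟨by linarith, ?_⟩
    have h3 : q * (1 - q) * l ≤ q * l := by nlinarith [mul_nonneg (mul_nonneg hq0 hq0) hl.le]
    have h4 : q * l ≤ (p + (l + 2 * √(p * l))) * l :=
      mul_le_mul_of_nonneg_right (by linarith) hl.le
    nlinarith
  linarith

/-- The width of the confidence interval after `n` relevant observations of a pair. -/
noncomputable def confWidth (p L : ℝ) (n : ℕ) : ℝ :=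
  if n = 0 then 1 / 2 else 4 * √(p * (L / n)) + 9 * (L / n)

theorem confWidth_nonneg {p L : ℝ} (hL : 0 < L) (n : ℕ) : 0 ≤ confWidth p L n := by
  unfold confWidth
  split_ifs
  · norm_num
  · positivity

theorem abs_pHat_sub_le {t : ℕ} {M : Model N K} {L : ℝ} (hL : 0 < L) {h : History N K t}
    {i : Fin N} {k : Fin K} (hn : 0 < pairCount h i k) (hdev : ¬ M.Deviates L h i k) :
    |pHat h i k - M.pairProb i k| ≤ L / pairCount h i k
      + 2 * √(M.pairProb i k * (1 - M.pairProb i k) * (L / pairCount h i k)) := by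
  have hn' : (0 : ℝ) < pairCount h i k := by exact_mod_cast hn
  simp only [Model.Deviates, hn, true_and, not_lt] at hdev
  set n := (pairCount h i k : ℝ)
  set p := M.pairProb i k
  have h1 : pHat h i k - p = (winCount h i k - p * n) / n := by
    rw [pHat, sub_div, mul_div_cancel_right₀ _ hn'.ne']
  have h2 : √(p * (1 - p) * (L / n)) = √(p * (1 - p) * n * L) / n := by
    rw [show p * (1 - p) * (L / n) = p * (1 - p) * n * L / n ^ 2 by field_simp,
      Real.sqrt_div' _ (sq_nonneg n), Real.sqrt_sq hn'.le]
  rw [h1, h2, abs_div, abs_of_pos hn', div_le_iff₀ hn']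
  refine hdev.trans_eq ?_
  field_simp

theorem exists_vUcb_eq {t T : ℕ} {M : Model N K} (hL : 0 < confL N K T) {h : History N K t}
    {i : Fin N} {k : Fin K} (hdev : ¬ M.Deviates (confL N K T) h i k) :
    ∃ u, vUcb T h i k = u / (1 - u) ∧ M.pairProb i k ≤ u ∧ u ≤ 1 / 2 ∧
      u ≤ M.pairProb i k + confWidth (M.pairProb i k) (confL N K T) (pairCount h i k) := by
  have hp0 := M.pairProb_pos i k
  have hp1 := M.pairProb_le_half i k
  rcases Nat.eq_zero_or_pos (pairCount h i k) with hn | hn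
  -- The default attraction `1` is the odds of `1/2`, the largest possible pair probability.
  · refine ⟨1 / 2, ?_, hp1, le_rfl, ?_⟩
    · rw [vUcb, if_neg (by omega)]
      norm_num
    · rw [confWidth, if_pos hn]
      linarith
  · have hn' : (0 : ℝ) < pairCount h i k := by exact_mod_cast hn
    have hl : 0 < confL N K T / pairCount h i k := by positivity
    have hq0 : 0 ≤ pHat h i k := by
      unfold pHat
      positivity
    have hq1 : pHat h i k ≤ 1 := by
      refine div_le_one_of_le₀ ?_ hn'.le
      exact_mod_cast winCount_le_pairCount h i k
    have habs := abs_le.1 (abs_pHat_sub_le hL hn hdev)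
    have hu : pUcb T h i k = min (pHat h i k
        + 2 * √(pHat h i k * (1 - pHat h i k) * (confL N K T / pairCount h i k))
        + 6 * (confL N K T / pairCount h i k)) (1 / 2) := by
      rw [pUcb, mul_div_assoc, mul_div_assoc 6]
    refine ⟨pUcb T h i k, by rw [vUcb, if_pos hn], ?_, min_le_right _ _, ?_⟩
    · rw [hu]
      exact le_min (le_bernstein_ucb hp0.le (by linarith) hq0 hq1 hl (by linarith)) hp1
    · rw [hu, confWidth, if_neg (by omega)]
      exact (min_le_left _ _).trans
        (bernstein_ucb_le hp0.le hq0 hl (by linarith))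

theorem le_vUcb {t T : ℕ} {M : Model N K} (hL : 0 < confL N K T) {h : History N K t}
    {i : Fin N} {k : Fin K} (hdev : ¬ M.Deviates (confL N K T) h i k) :
    M.v i k ≤ vUcb T h i k := by
  obtain ⟨u, hu, hpu, hu2, -⟩ := exists_vUcb_eq hL hdev
  have hv := M.v_pos i k
  rw [Model.pairProb, div_le_iff₀ (by linarith)] at hpu
  rw [hu, le_div_iff₀ (by linarith)]
  linarith

/-- The odds map satisfies `u/(1-u) - v = (1+v)(u-p)/(1-u)`. The cap `u ≤ 1/2` costs the factor `2`,
and `1 + v` later matches the observation probability. -/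
theorem vUcb_sub_le {t T : ℕ} {M : Model N K} (hL : 0 < confL N K T) {h : History N K t}
    {i : Fin N} {k : Fin K} (hdev : ¬ M.Deviates (confL N K T) h i k) :
    vUcb T h i k - M.v i k ≤ (1 + M.v i k) *
      (2 * confWidth (M.pairProb i k) (confL N K T) (pairCount h i k)) := by
  obtain ⟨u, hu, hpu, hu2, hub⟩ := exists_vUcb_eq hL hdev
  have hv := M.v_pos i k
  have h1 : u / (1 - u) - M.v i k = (1 + M.v i k) * ((u - M.pairProb i k) / (1 - u)) := by
    have : 1 - u ≠ 0 := by linarith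
    rw [Model.pairProb]
    field_simp
    ring
  rw [hu, h1]
  refine mul_le_mul_of_nonneg_left ?_ (by linarith)
  rw [div_le_iff₀ (by linarith)]
  nlinarith [confWidth_nonneg (p := M.pairProb i k) hL (pairCount h i k)]

/-! ### Revenues -/

/-- Linearizes the fractional revenue: comparing it with a target `ρ` amounts to comparing a sum
linear in `α` with `ρ`. -/
theorem one_add_mul_revenue_sub (r : Fin N → ℝ) {α : Fin N → Fin K → ℝ} (hα : ∀ i k, 0 ≤ α i k)
    (d : Decision N K) (ρ : ℝ) :
    (1 + totalAttraction α d) * (revenue r α d - ρ)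
      = ∑ j : d.1, (r j - ρ) * α j (d.2 j) - ρ := by
  have hA : 0 ≤ totalAttraction α d := Finset.sum_nonneg fun i _ => hα _ _
  have h1 : revenue r α d = (∑ j : d.1, r j * α j (d.2 j)) / (1 + totalAttraction α d) := by
    rw [revenue, ← Finset.sum_coe_sort, Finset.sum_div]
    refine Finset.sum_congr rfl fun j _ => ?_
    simp [choiceProb, mul_div_assoc]
  have h2 : ∑ j : d.1, (r j - ρ) * α j (d.2 j)
      = ∑ j : d.1, r j * α j (d.2 j) - ρ * totalAttraction α d := by
    rw [totalAttraction, Finset.mul_sum, ← Finset.sum_sub_distrib]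
    exact Finset.sum_congr rfl fun j _ => by ring
  rw [h2, h1]
  field_simp
  ring

theorem revenue_nonneg {r : Fin N → ℝ} (hr : ∀ i, 0 ≤ r i) {α : Fin N → Fin K → ℝ}
    (hα : ∀ i k, 0 ≤ α i k) (d : Decision N K) : 0 ≤ revenue r α d := by
  have hA : 0 ≤ totalAttraction α d := Finset.sum_nonneg fun i _ => hα _ _
  have h := one_add_mul_revenue_sub r hα d 0
  have h2 : 0 ≤ ∑ j : d.1, (r j - 0) * α j (d.2 j) :=
    Finset.sum_nonneg fun j _ => mul_nonneg (by simpa using hr j) (hα _ _)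
  by_contra! hlt
  nlinarith

theorem revenue_le_one {r : Fin N → ℝ} (hr : ∀ i, r i ≤ 1) {α : Fin N → Fin K → ℝ}
    (hα : ∀ i k, 0 ≤ α i k) (d : Decision N K) : revenue r α d ≤ 1 := by
  have hA : 0 ≤ totalAttraction α d := Finset.sum_nonneg fun i _ => hα _ _
  have h := one_add_mul_revenue_sub r hα d 1
  have h2 : ∑ j : d.1, (r j - 1) * α j (d.2 j) ≤ 0 :=
    Finset.sum_nonpos fun j _ => mul_nonpos_of_nonpos_of_nonneg (by linarith [hr j]) (hα _ _)
  by_contra! hlt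
  nlinarith

/-- Larger attractions allow at least the same revenue: products whose revenue is below the
target are withdrawn. -/
theorem exists_revenue_le_revenue (r : Fin N → ℝ) {v u : Fin N → Fin K → ℝ}
    (hv : ∀ i k, 0 ≤ v i k) (hvu : ∀ i k, v i k ≤ u i k) (d : Decision N K) :
    ∃ d' : Decision N K, revenue r v d ≤ revenue r u d' := by
  have hu : ∀ i k, 0 ≤ u i k := fun i k => (hv i k).trans (hvu i k)
  set ρ := revenue r v d with hρ
  let S := d.1.filter fun i => ρ ≤ r i
  have hS : ∀ {i}, i ∈ S → i ∈ d.1 := fun hi => (Finset.mem_filter.1 hi).1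
  let d' : Decision N K := ⟨S, ⟨fun j => d.2 ⟨j, hS j.2⟩, fun a b hab => by
    have := d.2.injective hab
    exact Subtype.ext (Subtype.mk.inj this)⟩⟩
  refine ⟨d', ?_⟩
  have h1 := one_add_mul_revenue_sub r hv d ρ
  rw [← hρ, sub_self, mul_zero, sum_offered d fun i k => (r i - ρ) * v i k] at h1
  have h2 := one_add_mul_revenue_sub r hu d' ρ
  rw [sum_offered d' fun i k => (r i - ρ) * u i k] at h2
  have hA : 0 ≤ totalAttraction u d' := Finset.sum_nonneg fun i _ => hu _ _
  have h3 : ∑ i, (if hi : i ∈ d.1 then (r i - ρ) * v i (d.2 ⟨i, hi⟩) else 0)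
      ≤ ∑ i, if hi : i ∈ d'.1 then (r i - ρ) * u i (d'.2 ⟨i, hi⟩) else 0 := by
    refine Finset.sum_le_sum fun i _ => ?_
    by_cases hi : i ∈ d.1
    · by_cases hr : ρ ≤ r i
      · have hi' : i ∈ d'.1 := Finset.mem_filter.2 ⟨hi, hr⟩
        rw [dif_pos hi, dif_pos hi']
        exact mul_le_mul_of_nonneg_left (hvu _ _) (by linarith)
      · have hi' : i ∉ d'.1 := fun h => hr (Finset.mem_filter.1 h).2
        rw [dif_pos hi, dif_neg hi']
        exact mul_nonpos_of_nonpos_of_nonneg (by linarith) (hv _ _)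
    · rw [dif_neg hi, dif_neg fun h => hi (hS h)]
  -- The sum for `d` under `v` equals `ρ`, and the sum for `d'` under `u` dominates it term by term,
  -- so `R(d'; u) - ρ` cannot be negative.
  by_contra! hlt
  nlinarith

/-- Linearizing both revenues at `ρ = revenue r u d` leaves coefficients `r j - ρ ≤ 1` on the
attraction gaps, and the denominator is that of the true attractions `v`. -/
theorem revenue_sub_revenue_le {r : Fin N → ℝ} (hr0 : ∀ i, 0 ≤ r i) (hr1 : ∀ i, r i ≤ 1)
    {v u : Fin N → Fin K → ℝ} (hv : ∀ i k, 0 ≤ v i k) (hvu : ∀ i k, v i k ≤ u i k)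
    (d : Decision N K) :
    revenue r u d - revenue r v d
      ≤ ∑ j : d.1, (u j (d.2 j) - v j (d.2 j)) / (1 + totalAttraction v d) := by
  have hu : ∀ i k, 0 ≤ u i k := fun i k => (hv i k).trans (hvu i k)
  have hρ := revenue_nonneg hr0 hu d
  have h1 := one_add_mul_revenue_sub r hv d (revenue r u d)
  have h2 := one_add_mul_revenue_sub r hu d (revenue r u d)
  rw [sub_self, mul_zero] at h2
  set ρ := revenue r u d
  have hA : 0 ≤ totalAttraction v d := Finset.sum_nonneg fun i _ => hv _ _
  rw [← Finset.sum_div, le_div_iff₀ (by linarith)]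
  have h3 : ∑ j : d.1, (r j - ρ) * u j (d.2 j) - ∑ j : d.1, (r j - ρ) * v j (d.2 j)
      ≤ ∑ j : d.1, (u j (d.2 j) - v j (d.2 j)) := by
    rw [← Finset.sum_sub_distrib]
    refine Finset.sum_le_sum fun j _ => ?_
    rw [← mul_sub]
    exact mul_le_of_le_one_left (sub_nonneg.2 (hvu _ _)) (by linarith [hr1 j])
  linarith

/-! ### The regret of one round -/

theorem Model.exists_revenue_eq_optRevenue (M : Model N K) :
    ∃ d, M.optRevenue = revenue M.r M.v d := by
  obtain ⟨d, -, hd⟩ := Finset.exists_mem_eq_sup' (Finset.univ_nonempty (α := Decision N K))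
    fun d => revenue M.r M.v d
  exact ⟨d, hd⟩

theorem Model.optRevenue_sub_le_one (M : Model N K) (d : Decision N K) :
    M.optRevenue - revenue M.r M.v d ≤ 1 := by
  obtain ⟨d₀, h⟩ := M.exists_revenue_eq_optRevenue
  have h1 := revenue_le_one M.r_le_one (fun i k => (M.v_pos i k).le) d₀
  have h2 := revenue_nonneg M.r_nonneg (fun i k => (M.v_pos i k).le) d
  linarith

open Classical in
theorem Model.optRevenue_sub_le {M : Model N K} {π : Policy N K} {t T : ℕ}
    (hπ : IsGP2UCB M.r T π) (ht : t < T) (hL : 0 < confL N K T) {h : History N K t}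
    (hdev : ¬ ∃ i k, M.Deviates (confL N K T) h i k) {d : Decision N K}
    (hd : d ∈ (π t h).support) :
    M.optRevenue - revenue M.r M.v d
      ≤ 2 * ∑ i, ∑ k, if d.Displays i k then (1 + M.v i k) / (1 + totalAttraction M.v d) *
          confWidth (M.pairProb i k) (confL N K T) (pairCount h i k) else 0 := by
  push Not at hdev
  have hv : ∀ i k, 0 ≤ M.v i k := fun i k => (M.v_pos i k).le
  have hvu : ∀ i k, M.v i k ≤ vUcb T h i k := fun i k => le_vUcb hL (hdev i k)
  obtain ⟨d₀, h₀⟩ := M.exists_revenue_eq_optRevenue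
  obtain ⟨d₁, h₁⟩ := exists_revenue_le_revenue M.r hv hvu d₀
  have h₂ := hπ t ht h d hd d₁
  have h₃ := revenue_sub_revenue_le M.r_nonneg M.r_le_one hv hvu d
  have hA := M.totalAttraction_nonneg d
  rw [sum_displays, Finset.mul_sum]
  refine le_trans (by linarith) (h₃.trans (Finset.sum_le_sum fun j _ => ?_))
  have h₄ := vUcb_sub_le hL (hdev j (d.2 j))
  calc _ ≤ _ := div_le_div_of_nonneg_right h₄ (by linarith)
    _ = _ := by ring

/-! ### The potential argument -/

/-- The accumulated width of the confidence intervals over `n` relevant observations. -/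
noncomputable def widthSum (p L : ℝ) (n : ℕ) : ℝ := ∑ m ∈ Finset.range n, confWidth p L m

open Classical in
theorem Model.sum_choiceProb_sum_pairCount_snoc {t : ℕ} (M : Model N K) (h : History N K t)
    (d : Decision N K) (Φ : Fin N → Fin K → ℕ → ℝ) :
    ∑ c, choiceProb M.v d c * ∑ i, ∑ k, Φ i k
        (pairCount (Fin.snoc (α := fun _ => Round N K) h (d, c) : History N K (t + 1)) i k)
      = ∑ i, ∑ k, Φ i k (pairCount h i k) + ∑ i, ∑ k, if d.Displays i k then
          (1 + M.v i k) / (1 + totalAttraction M.v d) *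
            (Φ i k (pairCount h i k + 1) - Φ i k (pairCount h i k)) else 0 := by
  simp_rw [← Finset.sum_add_distrib, ← M.sum_choiceProb_pairCount_snoc h d, Finset.mul_sum]
  rw [Finset.sum_comm]
  exact Finset.sum_congr rfl fun i _ => Finset.sum_comm

theorem Model.sum_choiceProb_mul_affine (M : Model N K) (d : Decision N K) (a b : ℝ)
    (g : Choice N → ℝ) :
    ∑ c, choiceProb M.v d c * (a - b * g c) = a - b * ∑ c, choiceProb M.v d c * g c := by
  simp only [mul_sub, Finset.sum_sub_distrib, mul_left_comm _ b]
  rw [← Finset.sum_mul, M.sum_choiceProb, one_mul, Finset.mul_sum]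

theorem Model.expect_regret_sub_widthSum_le {M : Model N K} {π : Policy N K} {T : ℕ}
    (hπ : IsGP2UCB M.r T π) (hL : 0 < confL N K T) {t : ℕ} (ht : t ≤ T) :
    M.expect π t (fun h => ∑ s : Fin t, (M.optRevenue - revenue M.r M.v (h s).1)
        - 2 * ∑ i, ∑ k, widthSum (M.pairProb i k) (confL N K T) (pairCount h i k))
      ≤ t * (2 * (K * N * T) * Real.exp (-(2 * confL N K T))) := by
  classical
  induction t with
  | zero =>
    rw [Model.expect_zero]
    simp [pairCount, widthSum]
  | succ t ih =>
    have hbad := M.expect_deviates_le π hL (Nat.le_of_succ_le ht)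
    have ih := ih (Nat.le_of_succ_le ht)
    rw [Model.expect_succ]
    refine le_trans (M.expect_mono π t (g := fun h =>
      (∑ s : Fin t, (M.optRevenue - revenue M.r M.v (h s).1)
        - 2 * ∑ i, ∑ k, widthSum (M.pairProb i k) (confL N K T) (pairCount h i k))
      + if ∃ i k, M.Deviates (confL N K T) h i k then 1 else 0)
      fun h => M.roundMean_le π h fun d hd => ?_) ?_
    · have hsum := M.sum_choiceProb_sum_pairCount_snoc h d
        fun i k => widthSum (M.pairProb i k) (confL N K T)
      simp only [Fin.sum_univ_castSucc, Fin.snoc_castSucc, Fin.snoc_last]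
      rw [M.sum_choiceProb_mul_affine, hsum]
      simp only [widthSum, Finset.sum_range_succ, add_sub_cancel_left]
      have key : M.optRevenue - revenue M.r M.v d
          ≤ 2 * (∑ i, ∑ k, if d.Displays i k then (1 + M.v i k) / (1 + totalAttraction M.v d) *
            confWidth (M.pairProb i k) (confL N K T) (pairCount h i k) else 0)
            + if ∃ i k, M.Deviates (confL N K T) h i k then 1 else 0 := by
        -- A round with a failed confidence bound is charged its maximal loss `1`.
        split_ifs with hdev
        · have h1 := M.optRevenue_sub_le_one d
          have h2 : 0 ≤ ∑ i, ∑ k, if d.Displays i k then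
              (1 + M.v i k) / (1 + totalAttraction M.v d) *
                confWidth (M.pairProb i k) (confL N K T) (pairCount h i k) else 0 := by
            refine Finset.sum_nonneg fun i _ => Finset.sum_nonneg fun k _ => ?_
            split_ifs
            · have := M.v_pos i k
              have := M.totalAttraction_nonneg d
              exact mul_nonneg (by positivity) (confWidth_nonneg hL _)
            · exact le_rfl
          linarith
        · rw [add_zero]
          exact Model.optRevenue_sub_le hπ ht hL hdev hd
      linarith
    · rw [M.expect_add]
      push_cast
      linarith

/-- The mean increase in one round is `∑ v/(1+A)` over displayed pairs, that is, the probability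
`A/(1+A)` of some purchase. -/
theorem Model.expect_sum_pairProb_mul_pairCount_le (M : Model N K) (π : Policy N K) (t : ℕ) :
    M.expect π t (fun h => ∑ i, ∑ k, M.pairProb i k * pairCount h i k) ≤ t := by
  classical
  induction t with
  | zero =>
    rw [Model.expect_zero]
    simp [pairCount]
  | succ t ih =>
    rw [Model.expect_succ]
    refine le_trans (M.expect_mono π t (g := fun h =>
      (∑ i, ∑ k, M.pairProb i k * pairCount h i k) + 1)
      fun h => M.roundMean_le π h fun d hd => ?_) ?_
    · rw [M.sum_choiceProb_sum_pairCount_snoc h d fun i k n => M.pairProb i k * n]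
      have hA := M.totalAttraction_nonneg d
      have h1 : ∀ i k, (1 + M.v i k) / (1 + totalAttraction M.v d) *
          (M.pairProb i k * ((pairCount h i k + 1 : ℕ) : ℝ) - M.pairProb i k * pairCount h i k)
          = M.v i k / (1 + totalAttraction M.v d) := fun i k => by
        have := M.v_pos i k
        rw [Model.pairProb]
        push_cast
        field_simp
        ring
      simp_rw [h1]
      rw [sum_displays d fun i k => M.v i k / (1 + totalAttraction M.v d), ← Finset.sum_div]
      gcongr
      refine div_le_one_of_le₀ ?_ (by linarith)
      rw [← totalAttraction]
      linarith
    · rw [M.expect_add, M.expect_const]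
      push_cast
      linarith

/-! ### The regret bound -/

theorem inv_sqrt_succ_le (n : ℕ) :
    (√((n + 1 : ℕ) : ℝ))⁻¹ ≤ 2 * (√((n + 1 : ℕ) : ℝ) - √(n : ℝ)) := by
  have hb0 := Real.sqrt_nonneg (n : ℝ)
  have ha0 : 0 < √((n + 1 : ℕ) : ℝ) := Real.sqrt_pos.2 (by positivity)
  have hb2 := Real.sq_sqrt (Nat.cast_nonneg (α := ℝ) n)
  have ha2 := Real.sq_sqrt (Nat.cast_nonneg (α := ℝ) (n + 1))
  set a := √((n + 1 : ℕ) : ℝ)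
  set b := √(n : ℝ)
  push_cast at ha2
  rw [inv_le_iff_one_le_mul₀ ha0]
  nlinarith [sq_nonneg (a - b)]

/-- The index `0` contributes the `1/2`. The remaining widths split into `1/√m`, which telescopes
against `2√m`, and `1/m`, which sums to the harmonic number. -/
theorem widthSum_succ_le {p L : ℝ} (hp : 0 ≤ p) (hL : 0 ≤ L) (n : ℕ) :
    widthSum p L (n + 1) ≤ 1 / 2 + 8 * √(p * L) * √n + 9 * L * (harmonic n : ℝ) := by
  induction n with
  | zero => simp [widthSum, confWidth]
  | succ n ih =>
    rw [widthSum, Finset.sum_range_succ, ← widthSum, harmonic_succ, confWidth,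
      if_neg (Nat.succ_ne_zero n)]
    have h1 : √(p * (L / ((n + 1 : ℕ) : ℝ))) = √(p * L) * (√((n + 1 : ℕ) : ℝ))⁻¹ := by
      rw [← mul_div_assoc, Real.sqrt_div (mul_nonneg hp hL), div_eq_mul_inv]
    have h2 := mul_le_mul_of_nonneg_left (inv_sqrt_succ_le n) (Real.sqrt_nonneg (p * L))
    rw [h1]
    push_cast at h2 ih ⊢
    have h3 : 9 * L * ((harmonic n : ℝ) + ((n : ℝ) + 1)⁻¹)
        = 9 * L * (harmonic n : ℝ) + 9 * (L / ((n : ℝ) + 1)) := by ring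
    rw [h3]
    linarith

theorem widthSum_le {p L : ℝ} (hp : 0 ≤ p) (hL : 0 ≤ L) {n T : ℕ} (hT : 1 ≤ T) (hn : n ≤ T) :
    widthSum p L n ≤ 1 / 2 + 8 * √L * √(p * n) + 9 * L * (1 + Real.log T) := by
  have hlogT : 0 ≤ Real.log T := Real.log_nonneg (by exact_mod_cast hT)
  cases n with
  | zero =>
    simp only [widthSum, Finset.range_zero, Finset.sum_empty]
    positivity
  | succ n =>
    have h1 := widthSum_succ_le hp hL n
    have h2 : √(p * L) * √n ≤ √L * √(p * ((n + 1 : ℕ) : ℝ)) := by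
      rw [← Real.sqrt_mul (mul_nonneg hp hL), ← Real.sqrt_mul hL]
      refine Real.sqrt_le_sqrt ?_
      push_cast
      nlinarith [mul_nonneg hp hL]
    have h3 : (harmonic n : ℝ) ≤ 1 + Real.log T := by
      refine (harmonic_le_one_add_log n).trans ?_
      rcases Nat.eq_zero_or_pos n with rfl | h
      · simpa using hlogT
      · have := Real.log_le_log (by exact_mod_cast h : (0 : ℝ) < n)
          (by exact_mod_cast (Nat.le_succ n).trans hn : (n : ℝ) ≤ T)
        linarith
    have h4 := mul_le_mul_of_nonneg_left h3 (by positivity : 0 ≤ 9 * L)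
    linarith

/-- The bound is affine in `x`, so expectations pass through it. With one common `a` it replaces
both Cauchy-Schwarz over pairs and Jensen. -/
theorem sqrt_le_amgm {x a : ℝ} (hx : 0 ≤ x) (ha : 0 < a) : √x ≤ (a * x + 1 / a) / 2 := by
  have h := Real.sq_sqrt hx
  have h2 : (a * x + 1 / a) / 2 - √x = (a * √x - 1) ^ 2 / (2 * a) := by
    field_simp
    linear_combination -a ^ 2 * h
  have : 0 ≤ (a * √x - 1) ^ 2 / (2 * a) := by positivity
  linarith

theorem confL_eq (N K T : ℕ) :
    confL N K T = Real.log (3 * K * N * T * ((⌈Real.logb 2 T⌉₊ : ℝ) + 1)) := by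
  rw [confL, confDelta, div_div_eq_mul_div]
  congr 1
  ring

theorem log_le_confL {T : ℕ} (hK : 1 ≤ K) (hN : 1 ≤ N) (hT : 1 ≤ T) :
    Real.log (3 * (K * N * T)) ≤ confL N K T := by
  have hK : (1 : ℝ) ≤ K := by exact_mod_cast hK
  have hN : (1 : ℝ) ≤ N := by exact_mod_cast hN
  have hT : (1 : ℝ) ≤ T := by exact_mod_cast hT
  rw [confL_eq]
  refine Real.log_le_log (by positivity) ?_
  have h : (0 : ℝ) ≤ 3 * (K * N * T) := by positivity
  nlinarith [mul_nonneg h (Nat.cast_nonneg (α := ℝ) ⌈Real.logb 2 T⌉₊)]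

theorem one_le_confL {T : ℕ} (hK : 1 ≤ K) (hN : 1 ≤ N) (hT : 1 ≤ T) : 1 ≤ confL N K T := by
  refine le_trans ?_ (log_le_confL hK hN hT)
  have h : (1 : ℝ) ≤ K * N * T := by exact_mod_cast Nat.mul_pos (Nat.mul_pos hK hN) hT
  rw [Real.le_log_iff_exp_le (by positivity)]
  have := Real.exp_one_lt_d9
  linarith

/-- Since `L ≥ log (3KNT)`, the total failure cost is at most `2T·KNT/(3KNT)² = 2/(9KN)`. -/
theorem failure_le_one {T : ℕ} (hK : 1 ≤ K) (hN : 1 ≤ N) (hT : 1 ≤ T) :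
    T * (2 * (K * N * T) * Real.exp (-(2 * confL N K T))) ≤ 1 := by
  have hm : (1 : ℝ) ≤ K * N := by exact_mod_cast Nat.mul_pos hK hN
  have hT' : (1 : ℝ) ≤ T := by exact_mod_cast hT
  have h0 : (0 : ℝ) < K * N * T := by positivity
  have h1 : Real.exp (-(2 * confL N K T)) ≤ 1 / (3 * (K * N * T)) ^ 2 := by
    have := log_le_confL hK hN hT
    rw [one_div, ← Real.exp_log (show (0 : ℝ) < (3 * (K * N * T)) ^ 2 by positivity),
      ← Real.exp_neg, Real.exp_le_exp, Real.log_pow]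
    push_cast
    linarith
  calc _ ≤ (T : ℝ) * (2 * (K * N * T) * (1 / (3 * (K * N * T)) ^ 2)) := by gcongr
    _ = 2 / (9 * (K * N : ℝ)) := by
      field_simp
      ring
    _ ≤ 1 := by
      rw [div_le_one (by positivity)]
      linarith

theorem Model.regret_eq_expect (M : Model N K) (π : Policy N K) (T : ℕ) :
    M.regret π T = M.expect π T fun h => ∑ s : Fin T, (M.optRevenue - revenue M.r M.v (h s).1) :=
  rfl

theorem Model.regret_le_horizon (M : Model N K) (π : Policy N K) (T : ℕ) : M.regret π T ≤ T := by
  rw [M.regret_eq_expect, ← M.expect_const π T (T : ℝ)]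
  refine M.expect_mono π T fun h => ?_
  calc _ ≤ ∑ _s : Fin T, (1 : ℝ) := Finset.sum_le_sum fun s _ => M.optRevenue_sub_le_one _
    _ = T := by simp

theorem Model.regret_le_of_isGP2UCB {M : Model N K} {π : Policy N K} {T : ℕ}
    (hK : 1 ≤ K) (hN : 1 ≤ N) (hT : 1 ≤ T) (hπ : IsGP2UCB M.r T π) :
    M.regret π T ≤ 1 + K * N + 16 * √(confL N K T) * √(K * N * T)
      + 18 * confL N K T * (K * N) * (1 + Real.log T) := by
  have hL1 := one_le_confL hK hN hT
  set L := confL N K T with hLdef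
  have hm : (0 : ℝ) < K * N := by exact_mod_cast Nat.mul_pos hK hN
  have hT' : (0 : ℝ) < T := by exact_mod_cast hT
  have hG2 : √((K : ℝ) * N * T) ^ 2 = K * N * T := Real.sq_sqrt (by positivity)
  have hG0 : 0 < √((K : ℝ) * N * T) := Real.sqrt_pos.2 (by positivity)
  set G := √((K : ℝ) * N * T)
  have hpot := Model.expect_regret_sub_widthSum_le hπ (by linarith) le_rfl
  have hfail := failure_le_one hK hN hT
  have hvis := M.expect_sum_pairProb_mul_pairCount_le π T
  rw [← hLdef] at hpot hfail
  have hsum : ∀ h : History N K T,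
      2 * ∑ i, ∑ k, widthSum (M.pairProb i k) L (pairCount h i k)
        ≤ (K * N * (1 + 18 * L * (1 + Real.log T)) + 8 * √L * G)
          + 8 * √L * (G / T) * ∑ i, ∑ k, M.pairProb i k * pairCount h i k := fun h => by
    have h1 : ∀ i k, widthSum (M.pairProb i k) L (pairCount h i k)
        ≤ (1 / 2 + 9 * L * (1 + Real.log T) + 4 * √L * (T / G))
          + 4 * √L * (G / T) * (M.pairProb i k * pairCount h i k) := fun i k => by
      have h2 := widthSum_le (M.pairProb_pos i k).le (by linarith : 0 ≤ L) hT (pairCount_le h i k)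
      -- The choice `a = G/T` balances the two halves: `KN·(T/G) = G` and `(G/T)·T = G`.
      have h3 := sqrt_le_amgm (x := M.pairProb i k * pairCount h i k) (a := G / T)
        (mul_nonneg (M.pairProb_pos i k).le (Nat.cast_nonneg _)) (by positivity)
      rw [one_div_div] at h3
      have h4 := mul_le_mul_of_nonneg_left h3 (by positivity : 0 ≤ 8 * √L)
      linarith
    have h5 : (K : ℝ) * N * (T / G) = G := by
      field_simp
      linarith
    calc _ ≤ 2 * ∑ i, ∑ k, ((1 / 2 + 9 * L * (1 + Real.log T) + 4 * √L * (T / G))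
          + 4 * √L * (G / T) * (M.pairProb i k * pairCount h i k)) :=
        mul_le_mul_of_nonneg_left (Finset.sum_le_sum fun i _ => Finset.sum_le_sum fun k _ =>
          h1 i k) (by norm_num)
      _ = (K * N * (1 + 18 * L * (1 + Real.log T)) + 8 * √L * (K * N * (T / G)))
          + 8 * √L * (G / T) * ∑ i, ∑ k, M.pairProb i k * pairCount h i k := by
        simp only [Finset.sum_add_distrib, ← Finset.mul_sum, Finset.sum_const, Finset.card_univ,
          Fintype.card_fin, nsmul_eq_mul]
        ring
      _ = _ := by rw [h5]
  have hexp : M.regret π T ≤ M.expect π T (fun h =>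
      (∑ s : Fin T, (M.optRevenue - revenue M.r M.v (h s).1)
        - 2 * ∑ i, ∑ k, widthSum (M.pairProb i k) L (pairCount h i k))
      + ((K * N * (1 + 18 * L * (1 + Real.log T)) + 8 * √L * G)
          + 8 * √L * (G / T) * ∑ i, ∑ k, M.pairProb i k * pairCount h i k)) := by
    rw [M.regret_eq_expect]
    exact M.expect_mono π T fun h => by linarith [hsum h]
  rw [M.expect_add, M.expect_add, M.expect_const, M.expect_mul_left] at hexp
  have hfin : 8 * √L * (G / T) * M.expect π T (fun h => ∑ i, ∑ k, M.pairProb i k * pairCount h i k)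
      ≤ 8 * √L * G := by
    calc _ ≤ 8 * √L * (G / T) * T := mul_le_mul_of_nonneg_left hvis (by positivity)
      _ = _ := by field_simp
  linarith

/-- Any `V` is allowed because the second entry of the maximum is already at least `1`, enough to
pay for the term `K * N`. -/
theorem Model.regret_le_regretBound {M : Model N K} {π : Policy N K} {T : ℕ}
    (hK : 1 ≤ K) (hN : 1 ≤ N) (hT : 1 ≤ T) (hπ : IsGP2UCB M.r T π) (V : ℝ) :
    M.regret π T ≤ regretBound N K T V := by
  have hL1 := one_le_confL hK hN hT
  have hreg := Model.regret_le_of_isGP2UCB hK hN hT hπ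
  have htriv := M.regret_le_horizon π T
  rw [regretBound, ← confL_eq]
  set L := confL N K T
  have hm : (1 : ℝ) ≤ K * N := by exact_mod_cast Nat.mul_pos hK hN
  have hT' : (1 : ℝ) ≤ T := by exact_mod_cast hT
  have hω : 1 ≤ 1 + Real.log T := by linarith [Real.log_nonneg hT']
  set ω := 1 + Real.log T
  have hG2 : √((K : ℝ) * N * T) ^ 2 = K * N * T := Real.sq_sqrt (by positivity)
  have hG0 : 0 < √((K : ℝ) * N * T) := Real.sqrt_pos.2 (by positivity)
  set G := √((K : ℝ) * N * T)
  have hy2 : √(ω * L) ^ 2 = ω * L := Real.sq_sqrt (by positivity)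
  have hy0 : 0 < √(ω * L) := Real.sqrt_pos.2 (by positivity)
  have hLy : √L ≤ √(ω * L) := Real.sqrt_le_sqrt (by nlinarith)
  set y := √(ω * L)
  -- Here `4√21 > 18`. The leading term needs `16` of these `18` units, and the absorbed remainder
  -- needs one more.
  have hlead : 18 * y ≤ 4 * √(21 * ω * L) := by
    have h21 : √(21 * ω * L) = √21 * y := by
      rw [mul_assoc, Real.sqrt_mul (by norm_num)]
    have : (9 / 2 : ℝ) ≤ √21 := Real.le_sqrt_of_sq_le (by norm_num)
    rw [h21]
    nlinarith
  have hleadG := mul_le_mul_of_nonneg_right hlead hG0.le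
  have hmax : (1 : ℝ) ≤ max (2 * Real.log (3 * K * N * T ^ 2) * (1 + V) ^ 2)
      (160 * L * (1 + K) ^ 2) := by
    refine le_trans ?_ (le_max_right _ _)
    have : (1 : ℝ) ≤ (1 + K) ^ 2 := one_le_pow₀ (by linarith [Nat.cast_nonneg (α := ℝ) K])
    nlinarith
  have hmmax := mul_le_mul_of_nonneg_left hmax (by linarith : (0 : ℝ) ≤ K * N)
  -- For small `T` the trivial bound suffices. Otherwise `18yG ≤ T` and `G² = KNT` give `18y·KN ≤
  -- G`, which bounds the remainder `18L·KN·ω` by `yG`.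
  rcases le_total (T : ℝ) (18 * y * G) with hcase | hcase
  · linarith
  · have h1 : 18 * y * (K * N) ≤ G := by
      have : (18 * y * G) * (K * N) ≤ G * G := by nlinarith
      nlinarith
    have h2 : 18 * L * (K * N) * ω ≤ y * G := by
      have : 18 * L * (K * N) * ω = y * (18 * y * (K * N)) := by
        linear_combination -18 * (K * N : ℝ) * hy2
      rw [this]
      exact mul_le_mul_of_nonneg_left h1 hy0.le
    have h3 : √L * G ≤ y * G := mul_le_mul_of_nonneg_right hLy hG0.le
    have h4 := mul_pos hy0 hG0
    linarith

/-! ### The rate -/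

theorem Model.totalAttraction_le (M : Model N K) (d : Decision N K) :
    totalAttraction M.v d ≤ K := by
  calc totalAttraction M.v d ≤ ∑ _j : d.1, (1 : ℝ) := Finset.sum_le_sum fun j _ => M.v_le_one _ _
    _ = d.1.card := by simp
    _ ≤ K := by exact_mod_cast d.card_le

theorem Model.Vmax_nonneg (M : Model N K) : 0 ≤ M.Vmax :=
  (M.totalAttraction_nonneg default).trans
    (Finset.le_sup' (fun d : Decision N K => totalAttraction M.v d) (Finset.mem_univ default))

theorem Model.Vmax_le (M : Model N K) : M.Vmax ≤ K :=
  Finset.sup'_le _ _ fun d _ => M.totalAttraction_le d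

theorem regretBound_le {T : ℕ} (hK : 1 ≤ K) (hN : 1 ≤ N) (hT : K * N * (1 + K) ^ 4 ≤ T) {V : ℝ}
    (hV0 : 0 ≤ V) (hV : V ≤ K) :
    regretBound N K T V ≤ 600 * √((K * N * T : ℕ) : ℝ) * Real.log ((K * N * T : ℕ) : ℝ) := by
  have hK' : (1 : ℝ) ≤ K := by exact_mod_cast hK
  have hm : (1 : ℝ) ≤ K * N := by exact_mod_cast Nat.mul_pos hK hN
  have hT' : (K * N : ℝ) * (1 + K) ^ 4 ≤ T := by exact_mod_cast hT
  have h16 : (16 : ℝ) ≤ (1 + K) ^ 4 := by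
    calc (16 : ℝ) = (1 + 1) ^ 4 := by norm_num
      _ ≤ _ := by gcongr
  have hT16 : (16 : ℝ) ≤ T := by nlinarith
  push_cast
  set m : ℝ := K * N
  set c : ℝ := (⌈Real.logb 2 T⌉₊ : ℝ) with hc
  have hX : 16 ≤ m * T := by nlinarith
  have hTX : (T : ℝ) ≤ m * T := by nlinarith
  set X := m * T with hXdef
  have hlog1 : 1 ≤ Real.log X := by
    rw [Real.le_log_iff_exp_le (by linarith)]
    have := Real.exp_one_lt_d9
    linarith
  have hcT : c ≤ T := by
    rw [hc]
    have h1 : Real.logb 2 T ≤ (T : ℕ) := by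
      rw [Real.logb_le_iff_le_rpow (by norm_num) (by linarith), Real.rpow_natCast]
      exact_mod_cast Nat.lt_two_pow_self.le
    exact_mod_cast Nat.ceil_le.2 h1
  have hc0 : 0 ≤ c := Nat.cast_nonneg _
  have hlog3 : Real.log (X ^ 3) = 3 * Real.log X := by
    rw [Real.log_pow]
    norm_num
  have hl1 : Real.log (3 * K * N * T ^ 2) ≤ 3 * Real.log X := by
    rw [← hlog3]
    refine Real.log_le_log (by positivity) ?_
    have : 3 * K * N * (T : ℝ) ^ 2 = 3 * X * T := by simp only [hXdef, m]; ring
    rw [this]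
    nlinarith [mul_le_mul_of_nonneg_left hTX (by linarith : (0 : ℝ) ≤ 3 * X),
      mul_le_mul_of_nonneg_right hX (sq_nonneg X)]
  have hl2 : Real.log (3 * K * N * T * (c + 1)) ≤ 3 * Real.log X := by
    rw [← hlog3]
    refine Real.log_le_log (by positivity) ?_
    have : 3 * K * N * (T : ℝ) * (c + 1) = 3 * X * (c + 1) := by simp only [hXdef, m]; ring
    rw [this]
    nlinarith [mul_le_mul_of_nonneg_left (by linarith : c + 1 ≤ 2 * X)
      (by linarith : (0 : ℝ) ≤ 3 * X), mul_le_mul_of_nonneg_right hX (sq_nonneg X)]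
  have hlT : 1 + Real.log T ≤ 2 * Real.log X := by
    have := Real.log_le_log (by linarith) hTX
    linarith
  -- This is the role of the horizon condition: the burn-in term drops to order `√X log X`. The
  -- constants add up to `1 + 480 + 4·12 ≤ 600`.
  have hmX : m * (1 + K) ^ 2 ≤ √X := by
    refine Real.le_sqrt_of_sq_le ?_
    have := mul_le_mul_of_nonneg_left hT' (by linarith : 0 ≤ m)
    calc _ = m * (m * (1 + K) ^ 4) := by ring
      _ ≤ _ := this
  have hsX : 1 ≤ √X := Real.one_le_sqrt.2 (by linarith)
  have hmax : max (2 * Real.log (3 * K * N * T ^ 2) * (1 + V) ^ 2)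
      (160 * Real.log (3 * K * N * T * (c + 1)) * (1 + K) ^ 2)
      ≤ 480 * Real.log X * (1 + K) ^ 2 := by
    refine max_le ?_ ?_
    · calc _ ≤ 2 * (3 * Real.log X) * (1 + K) ^ 2 := by gcongr
        _ ≤ _ := by
          refine mul_le_mul_of_nonneg_right ?_ (by positivity)
          linarith
    · calc _ ≤ 160 * (3 * Real.log X) * (1 + (K : ℝ)) ^ 2 := by gcongr
        _ = _ := by ring
  have hroot : √(21 * (1 + Real.log T) * Real.log (3 * K * N * T * (c + 1)))
      ≤ 12 * Real.log X := by
    refine Real.sqrt_le_iff.2 ⟨by linarith, ?_⟩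
    have hlT0 : 0 ≤ Real.log T := Real.log_nonneg (by linarith)
    have hl0 : 0 ≤ Real.log (3 * K * N * T * (c + 1)) := by
      refine Real.log_nonneg ?_
      have : 3 * K * N * (T : ℝ) * (c + 1) = 3 * X * (c + 1) := by simp only [hXdef, m]; ring
      rw [this]
      nlinarith
    calc _ ≤ 21 * (2 * Real.log X) * (3 * Real.log X) := by gcongr
      _ ≤ _ := by nlinarith [sq_nonneg (Real.log X)]
  have e1 : m * max (2 * Real.log (3 * K * N * T ^ 2) * (1 + V) ^ 2)
      (160 * Real.log (3 * K * N * T * (c + 1)) * (1 + K) ^ 2) ≤ 480 * Real.log X * √X := by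
    calc _ ≤ m * (480 * Real.log X * (1 + K) ^ 2) :=
          mul_le_mul_of_nonneg_left hmax (by linarith)
      _ = 480 * Real.log X * (m * (1 + K) ^ 2) := by ring
      _ ≤ _ := mul_le_mul_of_nonneg_left hmX (by linarith)
  have e2 := mul_le_mul_of_nonneg_right hroot (by linarith : 0 ≤ √X)
  have e3 : 1 ≤ √X * Real.log X := one_le_mul_of_one_le_of_one_le hsX hlog1
  rw [regretBound]
  linarith

end PosMNL

theorem theorem2 :
    (∀ (N K T : ℕ), 1 ≤ K → K ≤ N → 1 ≤ T →
      ∀ (M : Model N K) (π : Policy N K), IsGP2UCB M.r T π →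
        M.regret π T ≤ regretBound N K T M.Vmax) ∧
    (∃ C : ℝ, 0 < C ∧ ∀ (N K T : ℕ), 1 ≤ K → K ≤ N → K * N * (1 + K) ^ 4 ≤ T →
      ∀ M : Model N K,
        regretBound N K T M.Vmax ≤ C * √((K * N * T : ℕ) : ℝ) * Real.log ((K * N * T : ℕ) : ℝ)) :=
  ⟨fun _ _ _ hK hKN hT M _ hπ =>
      Model.regret_le_regretBound hK (hK.trans hKN) hT hπ M.Vmax,
    600, by norm_num, fun _ _ _ hK hKN hT M =>
      regretBound_le hK (hK.trans hKN) hT M.Vmax_nonneg M.Vmax_le⟩
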